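/- Let $n>1$, let $f:\{0,1\}^n\to\{0,1\}$ be any Boolean function and let $p$ be any probability distribution on $\{0,1\}^n$. In the binary non-local computation game $NLC_2$, Alice and Bob receive $x,y\in\{0,1\}^n$ with probability $2^{-n}p(x\oplus y)$, output bits $a,b$ without communicating, and win if $a\oplus b=f(x_1\oplus y_1,\dots,x_n\oplus y_n)$. The local Bell polytope $\mathcal L_n$ is the convex hull of the local deterministic boxes $P(a,b|x,y)=\mathbf 1[a=\alpha(x)]\,\mathbf 1[b=\beta(y)]$ with $\alpha,\beta:\{0,1\}^n\to\{0,1\}$, and the correlation polytope $\mathcal C_n$ is the set of all correlators $E_{x,y}=P(a=b|x,y)-P(a\ne b|x,y)$ of boxes $P\in\mathcal L_n$. Let $$\omega_c=\max_{P\in\mathcal L_n}\ \frac1{2^n}\sum_{x,y}p(x\oplus y)\,P\big(a\oplus b=f(x\oplus y)\,\big|\,x,y\big)$$ be the classical value of the game. An inequality $c\cdot v\le b$ defines a facet of a polytope $\mathcal P$ if $F=\{v\in\mathcal P : c\cdot v=b\}$ is a face of $\mathcal P$ with $\dim F=\dim\mathcal P-1$. Then the following hold. 1. The Bell inequality $$\frac1{2^n}\sum_{x,y}p(x\oplus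 y)\,P\big(a\oplus b=f(x\oplus y)\,\big|\,x,y\big)\le\omega_c$$ does not define a facet of $\mathcal L_n$. 2. The same inequality written in terms of correlators, $$\frac1{2^n}\sum_{x,y}p(x\oplus y)\,(-1)^{f(x\oplus y)}E_{x,y}\le 2\omega_c-1,$$ does not define a facet of $\mathcal C_n$. -/

import Mathlib

noncomputable section

/-! ### Polytopes in `ι → ℝ`: faces, dimension, facets -/

/-- The (affine) dimension of a set of points: the dimension of its affine hull. -/
def affineDim {ι : Type*} (P : Set (ι → ℝ)) : ℕ :=
  Module.finrank ℝ (vectorSpan ℝ P)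

/-- The part of `P` on the hyperplane `c ⬝ p = b`. -/
def hyperplaneSection {ι : Type*} [Fintype ι] (P : Set (ι → ℝ)) (c : ι → ℝ) (b : ℝ) :
    Set (ι → ℝ) :=
  {v | v ∈ P ∧ c ⬝ᵥ v = b}

/-- `F` is a face of `P`: either `F = P`, or `F` is the intersection of `P` with a supporting
hyperplane, that is, a hyperplane `c ⬝ p = b` with `b = max {c ⬝ p | p ∈ P}`. -/
def IsFace {ι : Type*} [Fintype ι] (P F : Set (ι → ℝ)) : Prop :=
  F = P ∨ ∃ (c : ι → ℝ) (b : ℝ),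
    IsGreatest ((fun v => c ⬝ᵥ v) '' P) b ∧ F = hyperplaneSection P c b

/-- `F` is a facet of `P`: a face with `dim F = dim P - 1`. -/
def IsFacet {ι : Type*} [Fintype ι] (P F : Set (ι → ℝ)) : Prop :=
  IsFace P F ∧ affineDim F + 1 = affineDim P

/-- The inequality `c ⬝ p ≤ b` defines a facet of `P`. -/
def IsFacetDefining {ι : Type*} [Fintype ι] (P : Set (ι → ℝ)) (c : ι → ℝ) (b : ℝ) : Prop :=
  IsFacet P (hyperplaneSection P c b)

/-! ### The Bell scenario: `n`-bit inputs and one-bit outputs for each of two parties -/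

/-- An `n`-bit string; addition is bitwise addition modulo two. -/
abbrev Bits (n : ℕ) : Type := Fin n → ZMod 2

/-- A box `P(a,b|x,y)`, a vector with one coordinate for each `(x, y, a, b)`. -/
abbrev Box (n : ℕ) : Type := Bits n × Bits n × ZMod 2 × ZMod 2 → ℝ

/-- The local deterministic box in which Alice outputs `α x` and Bob outputs `β y`. -/
def deterministicBox {n : ℕ} (α β : Bits n → ZMod 2) : Box n :=
  fun (x, y, a, b) => (if a = α x then 1 else 0) * (if b = β y then 1 else 0)

/-- The local Bell polytope: the convex combinations of local deterministic boxes. -/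
def localPolytope (n : ℕ) : Set (Box n) :=
  convexHull ℝ (Set.range fun s : (Bits n → ZMod 2) × (Bits n → ZMod 2) =>
    deterministicBox s.1 s.2)

/-- The correlators `⟨A_x B_y⟩ = P(a = b | x, y) - P(a ≠ b | x, y)` of a box. -/
def correlators {n : ℕ} (P : Box n) : Bits n × Bits n → ℝ :=
  fun (x, y) =>
    (∑ a : ZMod 2, ∑ b : ZMod 2, if a = b then P (x, y, a, b) else 0) -
      ∑ a : ZMod 2, ∑ b : ZMod 2, if a ≠ b then P (x, y, a, b) else 0

/-- The correlation polytope: all correlators of local boxes. -/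
def correlationPolytope (n : ℕ) : Set (Bits n × Bits n → ℝ) :=
  correlators '' localPolytope n

/-! ### Binary non-local computation games -/

/-- The coefficient vector of the success probability
`2⁻ⁿ ∑_{x,y} p(x ⊕ y) P(a ⊕ b = f(x ⊕ y) | x, y)` of the game. -/
def nlcCoeff {n : ℕ} (f : Bits n → ZMod 2) (p : Bits n → ℝ) : Box n :=
  fun (x, y, a, b) => if a + b = f (x + y) then (1 / 2 ^ n) * p (x + y) else 0

/-- The classical value of the game: the largest success probability over local boxes. -/
def nlcClassicalValue {n : ℕ} (f : Bits n → ZMod 2) (p : Bits n → ℝ) : ℝ :=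
  sSup ((fun P => nlcCoeff f p ⬝ᵥ P) '' localPolytope n)

/-- The game matrix `2⁻ⁿ p(x ⊕ y) (-1)^{f(x ⊕ y)}`: the coefficient vector of the game in terms
of correlators. -/
def nlcMatrix {n : ℕ} (f : Bits n → ZMod 2) (p : Bits n → ℝ) : Bits n × Bits n → ℝ :=
  fun (x, y) => (1 / 2 ^ n) * p (x + y) * (-1) ^ (f (x + y)).val

/-- The classical value is attained, so it is a maximum. -/
theorem nlcClassicalValue_isGreatest {n : ℕ} (f : Bits n → ZMod 2) (p : Bits n → ℝ) :
    IsGreatest ((fun P => nlcCoeff f p ⬝ᵥ P) '' localPolytope n) (nlcClassicalValue f p) := by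
  have hc : IsCompact (localPolytope n) := (Set.finite_range _).isCompact_convexHull ℝ
  have hne : (localPolytope n).Nonempty := (Set.range_nonempty _).convexHull
  refine (hc.image ?_).isGreatest_sSup (hne.image _)
  unfold dotProduct
  fun_prop

/-- Success probability and correlators: on local boxes, the success probability is
`(1 + ∑_{x,y} Φ_{x,y} ⟨A_x B_y⟩) / 2` with the game matrix `Φ`. Hence the inequality
stating that the success probability is at most `ω` reads `Φ ⬝ E ≤ 2 ω - 1` in terms of correlators. -/
theorem nlcCoeff_dotProduct {n : ℕ} (f : Bits n → ZMod 2) (p : Bits n → ℝ)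
    (hp : ∑ z, p z = 1) {P : Box n} (hP : P ∈ localPolytope n) :
    nlcCoeff f p ⬝ᵥ P = (1 + nlcMatrix f p ⬝ᵥ correlators P) / 2 := by
  have norm : ∀ x y : Bits n, ∑ a : ZMod 2, ∑ b : ZMod 2, P (x, y, a, b) = 1 := by
    intro x y
    have hconv : Convex ℝ {Q : Box n | ∑ a : ZMod 2, ∑ b : ZMod 2, Q (x, y, a, b) = 1} := by
      intro Q hQ R hR s t _ _ hst
      simp only [Set.mem_ofPred_eq, Pi.add_apply, Pi.smul_apply, smul_eq_mul,
        Finset.sum_add_distrib, ← Finset.mul_sum] at *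
      rw [hQ, hR]; linarith
    refine convexHull_min ?_ hconv hP
    rintro _ ⟨⟨α, β⟩, rfl⟩
    simp [deterministicBox]
  have tot : ∑ x : Bits n, ∑ y : Bits n, (1 / 2 ^ n : ℝ) * p (x + y) = 1 := by
    have h : ∀ x : Bits n, ∑ y : Bits n, (1 / 2 ^ n : ℝ) * p (x + y) = 1 / 2 ^ n := by
      intro x
      have e : ∑ y : Bits n, p (x + y) = ∑ z, p z := Equiv.sum_comp (Equiv.addLeft x) p
      rw [← Finset.mul_sum, e, hp, mul_one]
    simp only [h]
    simp
  have key : ∀ x y : Bits n,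
      ∑ a : ZMod 2, ∑ b : ZMod 2, nlcCoeff f p (x, y, a, b) * P (x, y, a, b) =
        ((1 / 2 ^ n : ℝ) * p (x + y) + nlcMatrix f p (x, y) * correlators P (x, y)) / 2 := by
    intro x y
    have hn := norm x y
    simp only [nlcCoeff, nlcMatrix, correlators]
    generalize f (x + y) = z at *
    generalize (1 / 2 ^ n : ℝ) * p (x + y) = q
    have e : ∀ g : ZMod 2 → ℝ, ∑ a, g a = g 0 + g 1 := fun g => Fin.sum_univ_two g
    simp only [e] at *
    have h11 : (1 : ZMod 2) + 1 = 0 := by decide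
    have v1 : (1 : ZMod 2).val = 1 := by decide
    have hz : z = 0 ∨ z = 1 := by revert z; decide
    rcases hz with rfl | rfl
    · simp [h11] at *
      linear_combination (q / 2) * hn
    · simp [h11, v1] at *
      linear_combination (q / 2) * hn
  have lhs : nlcCoeff f p ⬝ᵥ P =
      ∑ x, ∑ y, ∑ a, ∑ b, nlcCoeff f p (x, y, a, b) * P (x, y, a, b) := by
    simp only [dotProduct, Fintype.sum_prod_type]
  have rhs : nlcMatrix f p ⬝ᵥ correlators P =
      ∑ x, ∑ y, nlcMatrix f p (x, y) * correlators P (x, y) := by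
    simp only [dotProduct, Fintype.sum_prod_type]
  rw [lhs, rhs, ← tot]
  simp only [key, ← Finset.sum_add_distrib, Finset.sum_div]

end

/-! The game matrix has the form `g (x + y)`, so the Walsh characters diagonalise it. Characters are
sign vectors, hence classical strategies. A bound `B` on the game's correlator value over all
strategies therefore bounds every eigenvalue by `B / 2 ^ n` in absolute value, and Parseval turns
this into an operator norm bound (`sum_convolution_sq_le`).

A strategy attaining `B` is then an equality case: the matrix sends Alice's sign vector to `B / 2 ^
n` times Bob's (`convolution_eq_of_saturated`). So each of the `2 ^ n` columns contributes exactly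
`B / 2 ^ n`, first at saturating vertices and then on the whole face
(`columnValue_eq_of_saturated`). The column values are independent on the directions of the polytope
(`exists_mem_vectorSpan_columnValue`), so two different columns already give codimension at least
two (`affineDim_add_two_le`). -/

/-! ### Characters of `(ZMod 2)ⁿ` -/

/-- The sign `(-1)^a` of a bit. -/
def bitSign (a : ZMod 2) : ℝ := (-1) ^ a.val

theorem bitSign_zero : bitSign 0 = 1 := by simp [bitSign]

theorem bitSign_one : bitSign 1 = -1 := by
  have h : (1 : ZMod 2).val = 1 := by decide
  simp [bitSign, h]

theorem zmod_two_cases (a : ZMod 2) : a = 0 ∨ a = 1 := by revert a; decide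

theorem bitSign_add (a b : ZMod 2) : bitSign (a + b) = bitSign a * bitSign b := by
  have h : (1 : ZMod 2) + 1 = 0 := by decide
  rcases zmod_two_cases a with rfl | rfl <;> rcases zmod_two_cases b with rfl | rfl <;>
    simp [bitSign_zero, bitSign_one, h]

theorem bitSign_mul_self (a : ZMod 2) : bitSign a * bitSign a = 1 := by
  rcases zmod_two_cases a with rfl | rfl <;> simp [bitSign_zero, bitSign_one]

theorem bits_add_self {n : ℕ} (x : Bits n) : x + x = 0 := by
  funext i
  exact CharTwo.add_self_eq_zero _

/-- The Walsh character of `(ZMod 2)ⁿ` with frequency `k`. -/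
def walsh {n : ℕ} (k x : Bits n) : ℝ := bitSign (k ⬝ᵥ x)

theorem walsh_add_right {n : ℕ} (k x y : Bits n) : walsh k (x + y) = walsh k x * walsh k y := by
  simp [walsh, dotProduct_add, bitSign_add]

theorem walsh_add_left {n : ℕ} (k l x : Bits n) : walsh (k + l) x = walsh k x * walsh l x := by
  simp [walsh, add_dotProduct, bitSign_add]

theorem walsh_mul_self {n : ℕ} (k x : Bits n) : walsh k x * walsh k x = 1 :=
  bitSign_mul_self _

/-- For `z ≠ 0` some frequency `l` has sign `-1` at `z`; translating the summation variable by `l`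
negates the sum. -/
theorem sum_walsh {n : ℕ} (z : Bits n) :
    ∑ k : Bits n, walsh k z = if z = 0 then (2 : ℝ) ^ n else 0 := by
  split_ifs with hz
  · subst hz
    simp [walsh, bitSign_zero]
  · obtain ⟨i, hi⟩ : ∃ i, z i ≠ 0 := by
      by_contra! h
      exact hz (funext h)
    have hi1 : z i = 1 := (zmod_two_cases _).resolve_left hi
    obtain ⟨l, hl⟩ : ∃ l : Bits n, walsh l z = -1 :=
      ⟨Pi.single i 1, by simp [walsh, hi1, bitSign_one]⟩
    have h : ∑ k : Bits n, walsh (k + l) z = ∑ k : Bits n, walsh k z :=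
      Equiv.sum_comp (Equiv.addRight l) fun k => walsh k z
    simp only [walsh_add_left, hl, mul_neg, mul_one, Finset.sum_neg_distrib] at h
    linarith

theorem sum_walsh_mul_walsh {n : ℕ} (x y : Bits n) :
    ∑ k : Bits n, walsh k x * walsh k y = if x = y then (2 : ℝ) ^ n else 0 := by
  have h : x + y = 0 ↔ x = y := by
    refine ⟨fun h => ?_, fun h => h ▸ bits_add_self x⟩
    calc x = x + y + y := by rw [add_assoc, bits_add_self, add_zero]
      _ = y := by rw [h, zero_add]
  simp only [← walsh_add_right, sum_walsh, h]

/-- Parseval's identity for the Walsh transform. -/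
theorem sum_walshTransform_sq {n : ℕ} (u : Bits n → ℝ) :
    ∑ k : Bits n, (∑ x, walsh k x * u x) ^ 2 = 2 ^ n * ∑ x, u x ^ 2 := by
  have h : ∀ k : Bits n, (∑ x, walsh k x * u x) ^ 2 =
      ∑ x, ∑ y, (walsh k x * walsh k y) * (u x * u y) := by
    intro k
    rw [sq, Finset.sum_mul_sum]
    refine Finset.sum_congr rfl fun x _ => Finset.sum_congr rfl fun y _ => by ring
  simp only [h]
  rw [Finset.sum_comm, Finset.mul_sum]
  refine Finset.sum_congr rfl fun x _ => ?_
  rw [Finset.sum_comm]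
  simp only [← Finset.sum_mul, sum_walsh_mul_walsh, ite_mul, zero_mul, Finset.sum_ite_eq,
    Finset.mem_univ, if_true]
  ring

/-- The substitution `y = x + z` separates the double sum, since `x + x = 0`. The eigenvalue at `k`
is thus the Walsh transform of `g`. -/
theorem walshTransform_convolution {n : ℕ} (g u : Bits n → ℝ) (k : Bits n) :
    ∑ y, walsh k y * ∑ x, g (x + y) * u x =
      (∑ z, walsh k z * g z) * ∑ x, walsh k x * u x := by
  simp only [Finset.mul_sum]
  rw [Finset.sum_comm]
  refine Finset.sum_congr rfl fun x _ => ?_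
  rw [Finset.sum_mul, ← Equiv.sum_comp (Equiv.addLeft x)]
  refine Finset.sum_congr rfl fun z _ => ?_
  simp only [Equiv.coe_addLeft, walsh_add_right, ← add_assoc, bits_add_self, zero_add]
  ring

/-- A convolution matrix on `(ZMod 2)ⁿ` has all its eigenvalues attained at sign vectors, so a
bound for its values on sign vectors bounds its operator norm. -/
theorem sum_convolution_sq_le {n : ℕ} (g : Bits n → ℝ) (B : ℝ)
    (hB : ∀ α β : Bits n → ZMod 2,
      ∑ y, (∑ x, g (x + y) * bitSign (α x)) * bitSign (β y) ≤ B) (u : Bits n → ℝ) :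
    ∑ y, (∑ x, g (x + y) * u x) ^ 2 ≤ (B / 2 ^ n) ^ 2 * ∑ x, u x ^ 2 := by
  have hN : (0 : ℝ) < 2 ^ n := by positivity
  have hval : ∀ k : Bits n, ∑ y, (∑ x, g (x + y) * walsh k x) * walsh k y =
      2 ^ n * ∑ z, walsh k z * g z := by
    intro k
    have h := walshTransform_convolution g (walsh k) k
    simp only [walsh_mul_self] at h
    simp only [mul_comm _ (walsh k _)] at h ⊢
    rw [h]
    simp [mul_comm]
  have heig : ∀ k : Bits n, (∑ z, walsh k z * g z) ^ 2 ≤ (B / 2 ^ n) ^ 2 := by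
    intro k
    -- Both parties play the character `k`; complementing Bob's output changes the sign of the
    -- value, so the eigenvalue is bounded on both sides.
    have h1 := hB (fun x => k ⬝ᵥ x) (fun x => k ⬝ᵥ x)
    have h2 := hB (fun x => k ⬝ᵥ x) (fun x => k ⬝ᵥ x + 1)
    simp only [bitSign_add, bitSign_one, mul_neg, mul_one, Finset.sum_neg_distrib] at h2
    have h3 := hval k
    simp only [walsh] at h3
    rw [h3] at h1 h2
    apply sq_le_sq'
    · rw [neg_le, le_div_iff₀ hN]
      simp only [walsh]
      linarith
    · rw [le_div_iff₀ hN]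
      simp only [walsh]
      linarith
  have hsum := sum_walshTransform_sq (fun y => ∑ x, g (x + y) * u x)
  simp only [walshTransform_convolution, mul_pow] at hsum
  have hle : ∑ k : Bits n, (∑ z, walsh k z * g z) ^ 2 * (∑ x, walsh k x * u x) ^ 2 ≤
      (B / 2 ^ n) ^ 2 * (2 ^ n * ∑ x, u x ^ 2) := by
    rw [← sum_walshTransform_sq, Finset.mul_sum]
    exact Finset.sum_le_sum fun k _ => mul_le_mul_of_nonneg_right (heig k) (sq_nonneg _)
  rw [hsum, mul_left_comm] at hle
  exact le_of_mul_le_mul_left hle hN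

/-- If sign vectors attain the maximum of a convolution matrix, then they are singular vectors. -/
theorem convolution_eq_of_saturated {n : ℕ} (g : Bits n → ℝ) (B : ℝ)
    (hB : ∀ α β : Bits n → ZMod 2,
      ∑ y, (∑ x, g (x + y) * bitSign (α x)) * bitSign (β y) ≤ B) (α β : Bits n → ZMod 2)
    (h : ∑ y, (∑ x, g (x + y) * bitSign (α x)) * bitSign (β y) = B) (y : Bits n) :
    ∑ x, g (x + y) * bitSign (α x) = B / 2 ^ n * bitSign (β y) := by
  have hN : (2 : ℝ) ^ n ≠ 0 := by positivity
  have hle := sum_convolution_sq_le g B hB (fun x => bitSign (α x))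
  set w : Bits n → ℝ := fun y => ∑ x, g (x + y) * bitSign (α x) with hw
  have hcard : ∀ γ : Bits n → ZMod 2, ∑ x, bitSign (γ x) ^ 2 = 2 ^ n := by
    intro γ
    simp [sq, bitSign_mul_self]
  have hexp : ∑ y, (w y - B / 2 ^ n * bitSign (β y)) ^ 2 =
      ∑ y, w y ^ 2 - 2 * (B / 2 ^ n) * ∑ y, w y * bitSign (β y) +
        (B / 2 ^ n) ^ 2 * ∑ y, bitSign (β y) ^ 2 := by
    simp only [Finset.mul_sum, ← Finset.sum_sub_distrib, ← Finset.sum_add_distrib]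
    exact Finset.sum_congr rfl fun y _ => by ring
  -- The expansion is `∑ w² - B² / 2 ^ n`, which the operator norm bound makes nonpositive.
  have hzero : ∑ y, (w y - B / 2 ^ n * bitSign (β y)) ^ 2 = 0 := by
    refine le_antisymm ?_ (Finset.sum_nonneg fun y _ => sq_nonneg _)
    rw [hexp, h, hcard]
    rw [hcard] at hle
    have e : 2 * (B / 2 ^ n) * B = 2 * ((B / 2 ^ n) ^ 2 * 2 ^ n) := by
      field_simp
    linarith
  have := (Finset.sum_eq_zero_iff_of_nonneg fun y _ => sq_nonneg _).1 hzero y (Finset.mem_univ y)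
  exact sub_eq_zero.1 (pow_eq_zero_iff two_ne_zero |>.1 this)

/-! ### Correlators -/

/-- The correlators of a box, as a linear map. -/
def correlatorsLinear (n : ℕ) : Box n →ₗ[ℝ] (Bits n × Bits n → ℝ) where
  toFun := correlators
  map_add' P Q := by
    funext ⟨x, y⟩
    simp only [correlators, Pi.add_apply, ite_add_zero, Finset.sum_add_distrib]
    ring
  map_smul' r P := by
    funext ⟨x, y⟩
    simp only [correlators, Pi.smul_apply, smul_eq_mul, RingHom.id_apply, ← mul_ite_zero,
      ← Finset.mul_sum]
    ring

theorem correlators_deterministicBox {n : ℕ} (α β : Bits n → ZMod 2) (x y : Bits n) :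
    correlators (deterministicBox α β) (x, y) = bitSign (α x) * bitSign (β y) := by
  have e : ∀ g : ZMod 2 → ℝ, ∑ a, g a = g 0 + g 1 := fun g => Fin.sum_univ_two g
  simp only [correlators, deterministicBox, e]
  rcases zmod_two_cases (α x) with h | h <;> rcases zmod_two_cases (β y) with h' | h' <;>
    simp [h, h', bitSign_zero, bitSign_one]

/-- The contribution of the column `y` to the value of the matrix `c` on correlators. -/
def columnValue {n : ℕ} (c : Bits n × Bits n → ℝ) (y : Bits n) :
    (Bits n × Bits n → ℝ) →ₗ[ℝ] ℝ where
  toFun E := ∑ x, c (x, y) * E (x, y)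
  map_add' E E' := by simp [mul_add, Finset.sum_add_distrib]
  map_smul' r E := by simp [Finset.mul_sum, mul_left_comm]

theorem columnValue_apply {n : ℕ} (c E : Bits n × Bits n → ℝ) (y : Bits n) :
    columnValue c y E = ∑ x, c (x, y) * E (x, y) := rfl

theorem sum_columnValue {n : ℕ} (c E : Bits n × Bits n → ℝ) :
    ∑ y, columnValue c y E = c ⬝ᵥ E := by
  simp only [columnValue_apply, dotProduct, Fintype.sum_prod_type]
  exact Finset.sum_comm

theorem columnValue_deterministicBox {n : ℕ} (c : Bits n × Bits n → ℝ) (α β : Bits n → ZMod 2)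
    (y : Bits n) : columnValue c y (correlators (deterministicBox α β)) =
      (∑ x, c (x, y) * bitSign (α x)) * bitSign (β y) := by
  simp only [columnValue_apply, correlators_deterministicBox, Finset.sum_mul, mul_assoc]

/-- A linear functional bounded by `B` on `s` and a second one that is constant on the points of
`s` attaining `B`: the second one is constant on the points of the convex hull attaining `B`. -/
theorem eq_of_mem_convexHull_of_saturated {E : Type*} [AddCommGroup E] [Module ℝ E] {s : Set E}
    (φ ψ : E →ₗ[ℝ] ℝ) (B b : ℝ) (hs : ∀ v ∈ s, φ v ≤ B) (hb : ∀ v ∈ s, φ v = B → ψ v = b)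
    {v : E} (hv : v ∈ convexHull ℝ s) (hvB : φ v = B) : ψ v = b := by
  -- A proper convex combination reaches `B` only if both endpoints do, and then `ψ` equals `b` at
  -- both.
  have hconv : Convex ℝ {v : E | φ v < B ∨ (φ v = B ∧ ψ v = b)} := by
    intro v hv w hw r t hr ht hrt
    simp only [Set.mem_ofPred_eq, map_add, map_smul, smul_eq_mul] at *
    obtain rfl : t = 1 - r := by linarith
    rcases hr.eq_or_lt with rfl | hr
    · simpa using hw
    rcases ht.eq_or_lt with ht | ht
    · obtain rfl : r = 1 := by linarith
      simpa using hv
    rcases hv with hv | ⟨hv, hv'⟩ <;> rcases hw with hw | ⟨hw, hw'⟩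
    · left; nlinarith
    · left; nlinarith
    · left; nlinarith
    · right
      rw [hv, hv', hw, hw']
      constructor <;> ring
  have hsub : s ⊆ {v : E | φ v < B ∨ (φ v = B ∧ ψ v = b)} := by
    intro v hv
    rcases (hs v hv).lt_or_eq with h | h
    · exact Or.inl h
    · exact Or.inr ⟨h, hb v hv h⟩
  rcases convexHull_min hsub hconv hv with h | h
  · exact absurd hvB h.ne
  · exact h.2

/-- If a convolution matrix attains its maximum over local boxes at `P`, then all columns
contribute equally to its value. -/
theorem columnValue_eq_of_saturated {n : ℕ} (g : Bits n → ℝ) (B : ℝ)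
    (hB : ∀ P ∈ localPolytope n, (fun q => g (q.1 + q.2)) ⬝ᵥ correlators P ≤ B)
    {P : Box n} (hP : P ∈ localPolytope n)
    (h : (fun q => g (q.1 + q.2)) ⬝ᵥ correlators P = B) (y : Bits n) :
    columnValue (fun q => g (q.1 + q.2)) y (correlators P) = B / 2 ^ n := by
  set c : Bits n × Bits n → ℝ := fun q => g (q.1 + q.2) with hc
  have hval : ∀ α β : Bits n → ZMod 2, c ⬝ᵥ correlators (deterministicBox α β) =
      ∑ y, (∑ x, g (x + y) * bitSign (α x)) * bitSign (β y) := by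
    intro α β
    rw [← sum_columnValue]
    simp only [columnValue_deterministicBox, hc]
  have hB' : ∀ α β : Bits n → ZMod 2,
      ∑ y, (∑ x, g (x + y) * bitSign (α x)) * bitSign (β y) ≤ B := fun α β => by
    rw [← hval]
    exact hB _ (subset_convexHull ℝ _ ⟨(α, β), rfl⟩)
  have key := eq_of_mem_convexHull_of_saturated
    (s := Set.range fun s : (Bits n → ZMod 2) × (Bits n → ZMod 2) => deterministicBox s.1 s.2)
    ((∑ y, columnValue c y) ∘ₗ correlatorsLinear n) (columnValue c y ∘ₗ correlatorsLinear n)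
    B (B / 2 ^ n)
  simp only [LinearMap.comp_apply, LinearMap.sum_apply, sum_columnValue] at key
  refine key ?_ ?_ hP h
  · exact fun P hP => hB P (subset_convexHull ℝ _ hP)
  · rintro _ ⟨⟨α, β⟩, rfl⟩ hsat
    have hsat' : ∑ y, (∑ x, g (x + y) * bitSign (α x)) * bitSign (β y) = B := by
      rw [← hval]
      exact hsat
    have h1 := convolution_eq_of_saturated g B hB' α β hsat' y
    change columnValue c y (correlators (deterministicBox α β)) = _
    rw [columnValue_deterministicBox]
    simp only [hc]
    rw [h1, mul_assoc, bitSign_mul_self, mul_one]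

/-- Flipping Bob's output on the input `y` changes the contribution of the column `y` only. -/
theorem exists_mem_vectorSpan_columnValue {n : ℕ} (g : Bits n → ℝ) (hg : g ≠ 0) (y : Bits n) :
    ∃ v ∈ vectorSpan ℝ (localPolytope n),
      columnValue (fun q => g (q.1 + q.2)) y (correlatorsLinear n v) ≠ 0 ∧
      ∀ y' ≠ y, columnValue (fun q => g (q.1 + q.2)) y' (correlatorsLinear n v) = 0 := by
  classical
  set c : Bits n × Bits n → ℝ := fun q => g (q.1 + q.2) with hc
  obtain ⟨z, hz⟩ : ∃ z, g z ≠ 0 := Function.ne_iff.1 hg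
  -- Alice matches the signs of column `y`, so its sum becomes the `ℓ¹` norm of `g`, which is
  -- positive.
  let α : Bits n → ZMod 2 := fun x => if g (x + y) < 0 then 1 else 0
  have hα : ∀ x, g (x + y) * bitSign (α x) = |g (x + y)| := by
    intro x
    by_cases hx : g (x + y) < 0
    · simp [α, hx, bitSign_one, abs_of_neg hx]
    · simp [α, hx, bitSign_zero, abs_of_nonneg (not_lt.1 hx)]
  have hpos : 0 < ∑ x, g (x + y) * bitSign (α x) := by
    simp only [hα]
    refine Finset.sum_pos' (fun x _ => abs_nonneg _) ⟨z + y, Finset.mem_univ _, ?_⟩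
    rw [add_assoc, bits_add_self, add_zero]
    exact abs_pos.2 hz
  have hmem : ∀ β, deterministicBox α β ∈ localPolytope n := fun β =>
    subset_convexHull ℝ _ ⟨(α, β), rfl⟩
  -- The last factor is `2` at `y' = y` and `0` elsewhere.
  have hdiff : ∀ y', columnValue c y' (correlatorsLinear n
      (deterministicBox α 0 -ᵥ deterministicBox α (Pi.single y 1))) =
      (∑ x, g (x + y') * bitSign (α x)) * (1 - bitSign (Pi.single (M := fun _ => ZMod 2) y 1 y')) := by
    intro y'
    rw [vsub_eq_sub, map_sub, map_sub]
    change columnValue c y' (correlators _) - columnValue c y' (correlators _) = _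
    rw [columnValue_deterministicBox, columnValue_deterministicBox]
    simp only [hc, Pi.zero_apply, bitSign_zero]
    ring
  refine ⟨_, vsub_mem_vectorSpan ℝ (hmem 0) (hmem (Pi.single y 1)), ?_, fun y' hy' => ?_⟩
  · rw [hdiff, Pi.single_eq_same, bitSign_one]
    exact mul_ne_zero hpos.ne' (by norm_num)
  · rw [hdiff, Pi.single_eq_of_ne hy', bitSign_zero, sub_self, mul_zero]

/-! ### Dimension count -/

/-- Two linear functionals that are constant on `F ⊆ P` and independent on the direction of `P`
force `F` to have codimension at least two in `P`. -/
theorem affineDim_add_two_le {ι : Type*} [Fintype ι] {F P : Set (ι → ℝ)} (hFP : F ⊆ P)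
    (φ ψ : (ι → ℝ) →ₗ[ℝ] ℝ) (a b : ℝ) (hφ : ∀ v ∈ F, φ v = a) (hψ : ∀ v ∈ F, ψ v = b)
    {v w : ι → ℝ} (hv : v ∈ vectorSpan ℝ P) (hw : w ∈ vectorSpan ℝ P)
    (hφv : φ v ≠ 0) (hψv : ψ v = 0) (hφw : φ w = 0) (hψw : ψ w ≠ 0) :
    affineDim F + 2 ≤ affineDim P := by
  have hker : vectorSpan ℝ F ≤ LinearMap.ker (φ.prod ψ) := by
    rw [vectorSpan, Submodule.span_le]
    rintro _ ⟨x, hx, y, hy, rfl⟩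
    simp [hφ x hx, hφ y hy, hψ x hx, hψ y hy]
  let T : vectorSpan ℝ P →ₗ[ℝ] ℝ × ℝ := (φ.prod ψ) ∘ₗ (vectorSpan ℝ P).subtype
  have hsurj : LinearMap.range T = ⊤ := by
    rw [LinearMap.range_eq_top]
    rintro ⟨r, t⟩
    refine ⟨(r / φ v) • ⟨v, hv⟩ + (t / ψ w) • ⟨w, hw⟩, ?_⟩
    simp [T, hψv, hφw, hφv, hψw]
  have hrank := LinearMap.finrank_range_add_finrank_ker T
  rw [hsurj, finrank_top, Module.finrank_prod, Module.finrank_self] at hrank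
  -- `T` maps onto `ℝ × ℝ`, so its kernel has codimension two in the direction of `P`; it contains
  -- the direction of `F`.
  have hle : Module.finrank ℝ (vectorSpan ℝ F) ≤ Module.finrank ℝ (LinearMap.ker T) := by
    have hmono : vectorSpan ℝ F ≤ (LinearMap.ker T).map (vectorSpan ℝ P).subtype := by
      intro x hx
      exact ⟨⟨x, vectorSpan_mono ℝ hFP hx⟩, hker hx, rfl⟩
    exact (Submodule.finrank_mono hmono).trans (Submodule.finrank_map_le _ _)
  unfold affineDim
  omega

theorem mainTheorem1 (n : ℕ) (hn : 1 < n) (f : Bits n → ZMod 2) (p : Bits n → ℝ)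
    (hp_nonneg : ∀ z, 0 ≤ p z) (hp_sum : ∑ z, p z = 1) :
    ¬ IsFacetDefining (localPolytope n) (nlcCoeff f p) (nlcClassicalValue f p) ∧
      ¬ IsFacetDefining (correlationPolytope n) (nlcMatrix f p)
        (2 * nlcClassicalValue f p - 1) := by
  let g : Bits n → ℝ := fun z => (1 / 2 ^ n) * p z * bitSign (f z)
  have hmat : nlcMatrix f p = fun q => g (q.1 + q.2) := rfl
  have hg : g ≠ 0 := by
    intro h0
    have hp0 : ∀ z, p z = 0 := by
      intro z
      have hz : (1 / 2 ^ n) * p z * bitSign (f z) = 0 := congrFun h0 z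
      have hs : bitSign (f z) ≠ 0 := left_ne_zero_of_mul_eq_one (bitSign_mul_self (f z))
      simpa [hs] using hz
    simp [hp0] at hp_sum
  set B := 2 * nlcClassicalValue f p - 1 with hBdef
  have hB : ∀ P ∈ localPolytope n, (fun q => g (q.1 + q.2)) ⬝ᵥ correlators P ≤ B := by
    intro P hP
    have h1 := (nlcClassicalValue_isGreatest f p).2 ⟨P, hP, rfl⟩
    have h2 := nlcCoeff_dotProduct f p hp_sum hP
    rw [← hmat]
    simp only at h1
    linarith
  have hcol : ∀ P ∈ localPolytope n, nlcMatrix f p ⬝ᵥ correlators P = B → ∀ y,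
      columnValue (nlcMatrix f p) y (correlators P) = B / 2 ^ n :=
    fun P hP h y => columnValue_eq_of_saturated g B hB hP h y
  have h01 : (0 : Bits n) ≠ Pi.single ⟨0, by omega⟩ 1 := by
    intro h
    have := congrFun h ⟨0, by omega⟩
    simp at this
  set y₀ : Bits n := 0
  set y₁ : Bits n := Pi.single ⟨0, by omega⟩ 1
  obtain ⟨v, hv, hv₀, hv₁⟩ := exists_mem_vectorSpan_columnValue g hg y₀
  obtain ⟨w, hw, hw₁, hw₀⟩ := exists_mem_vectorSpan_columnValue g hg y₁
  constructor
  -- By `nlcCoeff_dotProduct`, success probability `ω` is the same as correlator value `2 ω - 1`, so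
  -- `hcol` applies on this face.
  · rintro ⟨-, hdim⟩
    have := affineDim_add_two_le (F := hyperplaneSection (localPolytope n) (nlcCoeff f p)
        (nlcClassicalValue f p)) (P := localPolytope n) (fun P hP => hP.1)
      (columnValue (nlcMatrix f p) y₀ ∘ₗ correlatorsLinear n)
      (columnValue (nlcMatrix f p) y₁ ∘ₗ correlatorsLinear n) (B / 2 ^ n) (B / 2 ^ n)
      (fun P hP => hcol P hP.1 (by
        have h1 := hP.2
        rw [nlcCoeff_dotProduct f p hp_sum hP.1] at h1
        linarith) y₀)
      (fun P hP => hcol P hP.1 (by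
        have h1 := hP.2
        rw [nlcCoeff_dotProduct f p hp_sum hP.1] at h1
        linarith) y₁) hv hw hv₀ (hv₁ _ h01.symm) (hw₀ _ h01) hw₁
    omega
  · rintro ⟨-, hdim⟩
    -- The column functionals factor through the correlators, so the images of `v` and `w` serve for
    -- the projected polytope.
    have hmap : ∀ v ∈ vectorSpan ℝ (localPolytope n),
        correlatorsLinear n v ∈ vectorSpan ℝ (correlationPolytope n) := by
      intro v hv
      have h : vectorSpan ℝ (correlationPolytope n) =
          (vectorSpan ℝ (localPolytope n)).map (correlatorsLinear n) :=
        ((correlatorsLinear n).toAffineMap.map_vectorSpan).symm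
      rw [h]
      exact Submodule.mem_map_of_mem hv
    have hface : ∀ y, ∀ E ∈ hyperplaneSection (correlationPolytope n) (nlcMatrix f p) B,
        columnValue (nlcMatrix f p) y E = B / 2 ^ n := by
      rintro y _ ⟨⟨P, hP, rfl⟩, h⟩
      exact hcol P hP h y
    have := affineDim_add_two_le (F := hyperplaneSection (correlationPolytope n)
        (nlcMatrix f p) B) (P := correlationPolytope n) (fun P hP => hP.1)
      (columnValue (nlcMatrix f p) y₀) (columnValue (nlcMatrix f p) y₁) (B / 2 ^ n) (B / 2 ^ n)
      (hface y₀) (hface y₁) (hmap v hv) (hmap w hw) hv₀ (hv₁ _ h01.symm) (hw₀ _ h01) hw₁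
    omega
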